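/- Let $d>1$ be an integer and let $\mathbb{M}^d$ be the $d$-dimensional Euclidean space, hyperbolic space (of constant sectional curvature $-1$) or spherical space (of constant sectional curvature $1$), with geodesic distance $\operatorname{dist}$ and volume $V$. For $x\in\mathbb{M}^d$ and $\rho>0$ let $\mathbf{B}[x,\rho]=\{y\in\mathbb{M}^d : \operatorname{dist}(x,y)\le\rho\}$, and for $X\subseteq\mathbb{M}^d$ and $r>0$ let $X^r=\bigcap_{x\in X}\mathbf{B}[x,r]$ be the $r$-dual set of $X$. Let $r>0$, and in the spherical case let in addition $r\le\pi/2$. Let $A\subseteq\mathbb{M}^d$ be a compact set with $V(A)>0$. If $B=\mathbf{B}[c,\rho]$, with $c\in\mathbb{M}^d$ and $\rho>0$, is a ball with $V(A)=V(B)$, then $V(A^r)\le V(B^r)$. -/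

import Mathlib

open MeasureTheory Set

namespace SpaceForm

/-- The closed ball `B[x, ρ]` with respect to a distance function `δ` on `M`. -/
def closedBall {M : Type*} (δ : M → M → ℝ) (x : M) (ρ : ℝ) : Set M :=
  {y | δ x y ≤ ρ}

/-- The `r`-dual set `X^r = ⋂_{x ∈ X} B[x, r]` with respect to a distance function `δ` on `M`. -/
def rDual {M : Type*} (δ : M → M → ℝ) (X : Set M) (r : ℝ) : Set M :=
  ⋂ x ∈ X, closedBall δ x r

/-- The unit sphere of `ℝ^{d+1}`: the `d`-dimensional spherical space (curvature `1`). -/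
abbrev Sph (d : ℕ) : Type :=
  Metric.sphere (0 : EuclideanSpace ℝ (Fin (d + 1))) 1

/-- The geodesic distance of the unit sphere: the angle between two unit vectors,
which is `arccos ⟪x, y⟫`. -/
noncomputable def sphDist {d : ℕ} (x y : Sph d) : ℝ :=
  InnerProductGeometry.angle (x : EuclideanSpace ℝ (Fin (d + 1))) y

/-- The spherical volume (surface measure of the unit sphere of `ℝ^{d+1}`). -/
noncomputable def sphVol (d : ℕ) : Measure (Sph d) :=
  (volume : Measure (EuclideanSpace ℝ (Fin (d + 1)))).toSphere

/-- The Lorentz form `x₁ y₁ + ⋯ + x_d y_d - x₀ y₀` on `ℝ^{d+1}`. -/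
def lorentz {d : ℕ} (x y : EuclideanSpace ℝ (Fin (d + 1))) : ℝ :=
  ∑ i : Fin d, x i.succ * y i.succ - x 0 * y 0

/-- The hyperboloid model of the `d`-dimensional hyperbolic space (curvature `-1`):
the upper sheet `⟨x, x⟩ = -1`, `x₀ > 0`, with the subspace topology. -/
abbrev Hyp (d : ℕ) : Type :=
  {x : EuclideanSpace ℝ (Fin (d + 1)) // lorentz x x = -1 ∧ 0 < x 0}

/-- The geodesic distance of the hyperboloid model: `cosh (dist x y) = -⟨x, y⟩`. -/
noncomputable def hypDist {d : ℕ} (x y : Hyp d) : ℝ :=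
  Real.arcosh (-lorentz (x : EuclideanSpace ℝ (Fin (d + 1))) y)

/-- The open future cone of `ℝ^{d+1}`. -/
abbrev FutureCone (d : ℕ) : Type :=
  {v : EuclideanSpace ℝ (Fin (d + 1)) // lorentz v v < 0 ∧ 0 < v 0}

theorem lorentz_smul_smul {d : ℕ} (a b : ℝ) (x y : EuclideanSpace ℝ (Fin (d + 1))) :
    lorentz (a • x) (b • y) = a * b * lorentz x y := by
  simp only [lorentz, PiLp.smul_apply, smul_eq_mul, mul_sub, Finset.mul_sum]
  congr 1
  · exact Finset.sum_congr rfl fun i _ => by ring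
  · ring

theorem continuous_lorentz_self {d : ℕ} :
    Continuous fun v : EuclideanSpace ℝ (Fin (d + 1)) => lorentz v v := by
  unfold lorentz
  fun_prop

/-- The radial projection `v ↦ v / √(-⟨v, v⟩)` of the future cone onto the hyperboloid. -/
noncomputable def radialProj {d : ℕ} (v : FutureCone d) : Hyp d :=
  ⟨(√(-lorentz v.1 v.1))⁻¹ • v.1, by
    have h : 0 < -lorentz v.1 v.1 := neg_pos.2 v.2.1
    have h' : 0 < √(-lorentz v.1 v.1) := Real.sqrt_pos.2 h
    refine ⟨?_, ?_⟩
    · rw [lorentz_smul_smul, ← mul_inv, Real.mul_self_sqrt h.le, inv_neg, neg_mul,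
        inv_mul_cancel₀ v.2.1.ne]
    · exact mul_pos (inv_pos.2 h') v.2.2⟩

/-- The hyperbolic volume in the hyperboloid model: the pushforward under the radial projection
of `d + 1` times the Lebesgue measure on `{v | -1 < ⟨v, v⟩ < 0, v₀ > 0}`. It is the Riemannian
volume `dvol` because the Lebesgue measure of the future cone is `t ^ d dt dvol(x)` in the
polar coordinates `v = t x` (`t > 0`, `x` on the hyperboloid). See `hypVol_apply`. -/
noncomputable def hypVol (d : ℕ) : Measure (Hyp d) :=
  (d + 1) • Measure.map radialProj
    (((volume : Measure (EuclideanSpace ℝ (Fin (d + 1)))).comap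
      (Subtype.val : FutureCone d → EuclideanSpace ℝ (Fin (d + 1)))).restrict
        {v | -1 < lorentz v.1 v.1})

theorem measurable_radialProj {d : ℕ} : Measurable (radialProj (d := d)) := by
  have h1 : Continuous fun v : FutureCone d => √(-lorentz v.1 v.1) :=
    (continuous_lorentz_self.comp continuous_subtype_val).neg.sqrt
  have h2 : Continuous fun v : FutureCone d => (√(-lorentz v.1 v.1))⁻¹ • v.1 :=
    (h1.inv₀ fun v => (Real.sqrt_pos.2 (neg_pos.2 v.2.1)).ne').smul continuous_subtype_val
  exact (h2.subtype_mk _).measurable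

theorem measurableSet_futureCone (d : ℕ) :
    MeasurableSet {v : EuclideanSpace ℝ (Fin (d + 1)) | lorentz v v < 0 ∧ 0 < v 0} := by
  have h : Continuous fun v : EuclideanSpace ℝ (Fin (d + 1)) => v 0 := by fun_prop
  exact ((isOpen_lt continuous_lorentz_self continuous_const).inter
    (isOpen_lt continuous_const h)).measurableSet

open scoped Pointwise in
/-- The hyperbolic volume of a Borel set `S` is `d + 1` times the Lebesgue measure of the
truncated cone over `S`, just as for the surface measure of the unit sphere. -/
theorem hypVol_apply {d : ℕ} {S : Set (Hyp d)} (hS : MeasurableSet S) :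
    hypVol d S = (d + 1) * volume (Ioo (0 : ℝ) 1 •
      ((Subtype.val : Hyp d → EuclideanSpace ℝ (Fin (d + 1))) '' S)) := by
  rw [hypVol, Measure.smul_apply, Measure.map_apply measurable_radialProj hS,
    Measure.restrict_apply (measurable_radialProj hS),
    nsmul_eq_mul, Nat.cast_add, Nat.cast_one]
  erw [(MeasurableEmbedding.subtype_coe (measurableSet_futureCone d)).comap_apply]
  congr 2
  ext w
  constructor
  · rintro ⟨v, ⟨hv, hv1⟩, rfl⟩
    have h : 0 < -lorentz v.1 v.1 := neg_pos.2 v.2.1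
    have h' : 0 < √(-lorentz v.1 v.1) := Real.sqrt_pos.2 h
    refine Set.mem_smul.2 ⟨√(-lorentz v.1 v.1), ⟨h', ?_⟩, _, ⟨_, hv, rfl⟩, ?_⟩
    · rw [Real.sqrt_lt' one_pos]
      have : -1 < lorentz v.1 v.1 := hv1
      linarith
    · simp only [radialProj]
      rw [smul_smul, mul_inv_cancel₀ h'.ne', one_smul]
  · intro hw
    obtain ⟨t, ⟨ht0, ht1⟩, _, ⟨x, hx, rfl⟩, rfl⟩ := Set.mem_smul.1 hw
    have hl : lorentz (t • x.1) (t • x.1) = -(t * t) := by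
      rw [lorentz_smul_smul, x.2.1]; ring
    refine ⟨⟨t • x.1, ?_, mul_pos ht0 x.2.2⟩, ⟨?_, ?_⟩, rfl⟩
    · rw [hl]; nlinarith
    · have : radialProj ⟨t • x.1, by rw [hl]; nlinarith, mul_pos ht0 x.2.2⟩ = x := by
        apply Subtype.ext
        simp only [radialProj]
        rw [hl, neg_neg, Real.sqrt_mul_self ht0.le, smul_smul, inv_mul_cancel₀ ht0.ne', one_smul]
      rwa [mem_preimage, this]
    · rw [mem_ofPred_eq, hl]; nlinarith

end SpaceForm

/-! The proof is by two-point symmetrization. Call two compact sets `A`, `D` an `r`-pair if all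
distances between their points are at most `r`; the pair `(A, A^r)` is one. Polarizing both sets in
the same half-space keeps them an `r`-pair (`IsHalfSpace.le_of_polarize`) and loses no volume.

Fix `B` centred at `o` and consider all `r`-pairs inside a large ball about `o` whose volumes are at
least those of `A` and `A^r`. They form a compact family in the Vietoris topology, and the volume of
the part of the first set in `B` is upper semicontinuous, so some pair `(A', D')` maximizes it. If
`A'` missed a part of `B` of positive volume, then `A' \ B` would have positive volume too, since
`A'` has at least the volume of `B`. A reflection carrying a density point of `A' \ B` to one of `B
\ A'`, with half-space containing `o`, would then strictly increase the overlap
(`measure_inter_add_le_measure_polarize_inter`). Hence `B ⊆ A'`, so `D' ⊆ B^r`, and the volume of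
`A^r` is at most that of `D'`.

Only the supply of reflections depends on the geometry. In Euclidean space they are reflections in
perpendicular bisectors. The sphere and the hyperboloid are both handled by
`measure_rDual_le_of_form`: isometries are restrictions of linear reflections preserving a bilinear
form, and volume is Lebesgue measure of cones, so the density argument takes place in the ambient
vector space. -/

namespace SpaceForm

open Filter Topology TopologicalSpace
open scoped ENNReal Pointwise RealInnerProductSpace

/-! ### Two-point symmetrization -/

section Polarization

variable {M : Type*} {δ : M → M → ℝ} {σ : M → M} {H A D : Set M}

/-- A half-space `H` together with the reflection `σ` in its boundary. -/
structure IsHalfSpace (δ : M → M → ℝ) (σ : M → M) (H : Set M) : Prop where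
  invol : Function.Involutive σ
  isom : ∀ a b, δ (σ a) (σ b) = δ a b
  mem_or : ∀ a, a ∈ H ∨ σ a ∈ H
  le : ∀ a ∈ H, ∀ b ∈ H, δ a b ≤ δ a (σ b)

/-- The two-point symmetrization of `A` with respect to `H`. -/
def polarize (σ : M → M) (H A : Set M) : Set M :=
  (A ∩ σ ⁻¹' A) ∪ ((A ∪ σ ⁻¹' A) ∩ H)

/-- The original or the mirrored pair of points lies in `A × D`, unless exactly one of the two
points has to be reflected. In that mixed case both points are in `H`, where reflecting one of them
can only increase the distance. -/
theorem IsHalfSpace.le_of_polarize (h : IsHalfSpace δ σ H) {r : ℝ}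
    (hr : ∀ a ∈ A, ∀ b ∈ D, δ a b ≤ r) :
    ∀ a ∈ polarize σ H A, ∀ b ∈ polarize σ H D, δ a b ≤ r := by
  have flip : ∀ a b, σ a ∈ A → σ b ∈ D → δ a b ≤ r := fun a b ha hb => by
    rw [← h.isom]; exact hr _ ha _ hb
  have flip' : ∀ a b, δ (σ a) b = δ a (σ b) := fun a b => by
    rw [← h.isom, h.invol]
  rintro a (⟨ha, ha'⟩ | ⟨ha | ha, haH⟩) b (⟨hb, hb'⟩ | ⟨hb | hb, hbH⟩)
  · exact hr _ ha _ hb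
  · exact hr _ ha _ hb
  · exact flip _ _ ha' hb
  · exact hr _ ha _ hb
  · exact hr _ ha _ hb
  · exact (h.le a haH b hbH).trans (hr _ ha _ hb)
  · exact flip _ _ ha hb'
  · exact (h.le a haH b hbH).trans ((flip' a b).symm.trans_le (hr _ ha _ hb))
  · exact flip _ _ ha hb

theorem IsHalfSpace.polarize_subset_closedBall (h : IsHalfSpace δ σ H) {o : M} (ho : o ∈ H)
    {R : ℝ} (hA : A ⊆ closedBall δ o R) : polarize σ H A ⊆ closedBall δ o R := by
  rintro x (⟨hx, -⟩ | ⟨hx | hx, hxH⟩)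
  · exact hA hx
  · exact hA hx
  · exact (h.le o ho x hxH).trans (hA hx)

theorem isCompact_polarize [TopologicalSpace M] [T2Space M] (hσ : Function.Involutive σ)
    (hc : Continuous σ) (hH : IsClosed H) (hA : IsCompact A) : IsCompact (polarize σ H A) := by
  have h1 : IsCompact (σ ⁻¹' A) := by
    rw [← image_eq_preimage_of_inverse hσ.leftInverse hσ.rightInverse]
    exact hA.image hc
  exact (hA.inter h1).union ((hA.union h1).inter_right hH)

variable [MeasurableSpace M] {μ : Measure M}

/-- Polarization does not decrease the measure of the part of `A` in a set `B` which it fixes;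
it increases it at least by the measure of the points of `B \ A` whose mirror image lies
in `A \ B`. -/
theorem measure_inter_add_le_measure_polarize_inter {B : Set M} (hσ : Function.Involutive σ)
    (hH : ∀ a, a ∈ H ∨ σ a ∈ H) (hm : MeasurePreserving σ μ μ) (hHm : MeasurableSet H)
    (hA : MeasurableSet A) (hB : MeasurableSet B) (hBH : ∀ x ∈ B, σ x ∈ H → σ x ∈ B) :
    μ (A ∩ B) + μ ((B \ A) ∩ σ ⁻¹' (A \ B)) ≤ μ (polarize σ H A ∩ B) := by
  -- `S` is the part of `A` that polarization moves across the mirror; the rest of `A` stays.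
  set S : Set M := A ∩ Hᶜ ∩ (σ ⁻¹' A)ᶜ with hS
  have hσA : MeasurableSet (σ ⁻¹' A) := hm.measurable hA
  have hSm : MeasurableSet S := (hA.inter hHm.compl).inter hσA.compl
  have h1 : μ (A ∩ B) = μ ((A ∩ B) \ S) + μ (σ ⁻¹' (A ∩ B ∩ S)) := by
    rw [hm.measure_preimage ((hA.inter hB).inter hSm).nullMeasurableSet, add_comm,
      measure_inter_add_sdiff _ hSm]
  have hm1 : MeasurableSet (σ ⁻¹' (A ∩ B ∩ S)) := hm.measurable ((hA.inter hB).inter hSm)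
  have hm2 : MeasurableSet ((B \ A) ∩ σ ⁻¹' (A \ B)) :=
    (hB.diff hA).inter (hm.measurable (hA.diff hB))
  rw [h1, ← measure_union _ hm1, ← measure_union _ hm2]
  · apply measure_mono
    rintro x ((⟨⟨hxA, hxB⟩, hxS⟩ | ⟨⟨hxA, hxB⟩, ⟨-, hxH⟩, hxA'⟩) | ⟨⟨hxB, hxA⟩, hx1, hx2⟩)
    · refine ⟨?_, hxB⟩
      by_cases hH' : x ∈ H
      · exact Or.inr ⟨Or.inl hxA, hH'⟩
      · exact Or.inl ⟨hxA, by_contra fun h => hxS ⟨⟨hxA, hH'⟩, h⟩⟩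
    · have hx : x ∈ H := (hH x).resolve_right hxH
      refine ⟨Or.inr ⟨Or.inr hxA, hx⟩, ?_⟩
      have := hBH _ hxB
      rw [hσ] at this
      exact this hx
    -- The gained points lie in `H`: otherwise `σ x ∈ H`, and then `hBH` would put `σ x` in `B`.
    · refine ⟨Or.inr ⟨Or.inr hx1, ?_⟩, hxB⟩
      exact (hH x).resolve_right fun h => hx2 (hBH _ hxB h)
  · rw [Set.disjoint_left]
    rintro x (⟨⟨hxA, hxB⟩, hxS⟩ | ⟨⟨hxA, hxB⟩, ⟨-, hxH⟩, hxA'⟩) ⟨⟨hxB', hxA'⟩, hx1, hx2⟩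
    · exact hxA' hxA
    · exact hx2 hxB
  · rw [Set.disjoint_left]
    rintro x ⟨⟨hxA, hxB⟩, hxS⟩ ⟨⟨hxA2, hxB2⟩, ⟨-, hxH⟩, hxA'⟩
    apply hxA'
    simpa [hσ x] using hxA

theorem measure_le_measure_polarize (hσ : Function.Involutive σ)
    (hH : ∀ a, a ∈ H ∨ σ a ∈ H) (hm : MeasurePreserving σ μ μ) (hHm : MeasurableSet H)
    (hA : MeasurableSet A) : μ A ≤ μ (polarize σ H A) := by
  simpa using measure_inter_add_le_measure_polarize_inter hσ hH hm hHm hA MeasurableSet.univ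
    (fun _ _ _ => mem_univ _)

end Polarization

/-! ### Semicontinuity in the Vietoris topology -/

section Compactness

variable {M : Type*} [TopologicalSpace M]

/-- Outer regularity encloses `K` in an open set of hardly larger measure, which also contains every
compact set near `K`. -/
theorem isClosed_setOf_le_measure [MeasurableSpace M] (μ : Measure M) [μ.OuterRegular]
    (v : ℝ≥0∞) : IsClosed {K : Compacts M | v ≤ μ K} := by
  rw [← isOpen_compl_iff, isOpen_iff_mem_nhds]
  intro K hK
  obtain ⟨U, hKU, hU, hμU⟩ := Set.exists_isOpen_lt_of_lt (K : Set M) v (not_le.1 hK)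
  filter_upwards [(Compacts.isOpen_subsets_of_isOpen hU).mem_nhds hKU] with L hL
  exact not_le.2 ((measure_mono hL).trans_lt hμU)

theorem upperSemicontinuous_measure_inter [T2Space M] [MeasurableSpace M] [BorelSpace M]
    (μ : Measure M) [μ.OuterRegular] {B : Set M} (hB : IsCompact B) :
    UpperSemicontinuous fun K : Compacts M => μ (K ∩ B) := by
  intro K v hv
  obtain ⟨U, hKU, hU, hμU⟩ := Set.exists_isOpen_lt_of_lt _ v hv
  have hsub : (K : Set M) ⊆ U ∪ Bᶜ := fun x hx => by
    by_cases hxB : x ∈ B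
    · exact Or.inl (hKU ⟨hx, hxB⟩)
    · exact Or.inr hxB
  filter_upwards [(Compacts.isOpen_subsets_of_isOpen
    (hU.union hB.isClosed.isOpen_compl)).mem_nhds hsub] with L hL
  refine (measure_mono ?_).trans_lt hμU
  rintro x ⟨hx, hxB⟩
  exact (hL hx).resolve_right fun h => h hxB

/-- A violating pair of points has a product neighbourhood of violating pairs, and nearby compact
sets still meet both factors. -/
theorem isClosed_setOf_forall_le {δ : M → M → ℝ} (hδ : Continuous (Function.uncurry δ)) (r : ℝ) :
    IsClosed {P : Compacts M × Compacts M | ∀ a ∈ P.1, ∀ b ∈ P.2, δ a b ≤ r} := by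
  rw [← isOpen_compl_iff, isOpen_iff_mem_nhds]
  rintro ⟨K, L⟩ hKL
  simp only [mem_compl_iff, mem_ofPred_eq, not_forall, not_le] at hKL
  obtain ⟨a, ha, b, hb, hab⟩ := hKL
  obtain ⟨U, V, hU, hV, haU, hbV, hUV⟩ := isOpen_prod_iff.1
    (isOpen_lt continuous_const hδ : IsOpen {p : M × M | r < Function.uncurry δ p}) a b hab
  have h1 := (Compacts.isOpen_inter_nonempty_of_isOpen hU).mem_nhds (x := K) ⟨a, ha, haU⟩
  have h2 := (Compacts.isOpen_inter_nonempty_of_isOpen hV).mem_nhds (x := L) ⟨b, hb, hbV⟩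
  filter_upwards [prod_mem_nhds h1 h2]
  rintro ⟨K', L'⟩ ⟨⟨a', ha', haU'⟩, ⟨b', hb', hbV'⟩⟩ hle
  have : r < δ a' b' := hUV (mk_mem_prod haU' hbV')
  exact absurd (hle a' ha' b' hb') (not_le.2 this)

end Compactness

/-! ### The extremal argument -/

/-- A metric measure space with enough reflections satisfies the volume inequality for
dual sets. -/
theorem measure_rDual_le_of_reflections {M : Type*} [TopologicalSpace M] [T2Space M]
    [MeasurableSpace M] [BorelSpace M] (μ : Measure M) [IsFiniteMeasureOnCompacts μ]
    [μ.OuterRegular] [μ.IsOpenPosMeasure] {δ : M → M → ℝ}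
    (hδ : Continuous (Function.uncurry δ)) (hcpt : ∀ x R, IsCompact (closedBall δ x R))
    {o : M} {ρ : ℝ} (hball : closedBall δ o ρ ⊆ closure {y | δ o y < ρ})
    (hrefl : ∀ U W : Set M, MeasurableSet U → MeasurableSet W → μ U ≠ 0 → μ W ≠ 0 →
      (∀ u ∈ U, ∀ w ∈ W, δ o w < δ o u) → ∃ (σ : M → M) (H : Set M), IsHalfSpace δ σ H ∧
        Continuous σ ∧ MeasurePreserving σ μ μ ∧ IsClosed H ∧ o ∈ H ∧ μ (W ∩ σ ⁻¹' U) ≠ 0)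
    {r : ℝ} {A : Set M} (hA : IsCompact A) (hA0 : A.Nonempty)
    (hAB : μ A = μ (closedBall δ o ρ)) :
    μ (rDual δ A r) ≤ μ (rDual δ (closedBall δ o ρ) r) := by
  set B := closedBall δ o ρ with hBdef
  have hBc : IsCompact B := hcpt o ρ
  obtain ⟨a₀, ha₀⟩ := hA0
  have hδo : Continuous (δ o) := hδ.comp (by fun_prop : Continuous fun y : M => (o, y))
  have hD : IsCompact (rDual δ A r) := by
    refine (hcpt a₀ r).of_isClosed_subset ?_ (biInter_subset_of_mem ha₀)
    exact isClosed_biInter fun x _ => (hcpt x r).isClosed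
  obtain ⟨R, hR⟩ := (hA.union hD).bddAbove_image hδo.continuousOn
  have hR' : A ∪ rDual δ A r ⊆ closedBall δ o R := fun x hx => hR (mem_image_of_mem _ hx)
  set K := closedBall δ o R with hKdef
  set X : Set (Compacts M × Compacts M) :=
    ({L : Compacts M | (L : Set M) ⊆ K} ×ˢ {L : Compacts M | (L : Set M) ⊆ K}) ∩
    (({L : Compacts M | μ A ≤ μ L} ×ˢ {L : Compacts M | μ (rDual δ A r) ≤ μ L}) ∩
      {P | ∀ a ∈ P.1, ∀ b ∈ P.2, δ a b ≤ r}) with hX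
  have hKX := Compacts.isCompact_subsets_of_isCompact (hcpt o R)
  have hXc : IsCompact X := (hKX.prod hKX).inter_right
    (((isClosed_setOf_le_measure μ _).prod (isClosed_setOf_le_measure μ _)).inter
      (isClosed_setOf_forall_le hδ r))
  have hXne : X.Nonempty := ⟨(⟨A, hA⟩, ⟨rDual δ A r, hD⟩),
    ⟨subset_union_left.trans hR', subset_union_right.trans hR'⟩, ⟨le_refl (μ A), le_refl (μ (rDual δ A r))⟩,
    fun a ha b hb => mem_iInter₂.1 hb a ha⟩
  obtain ⟨⟨A', D'⟩, ⟨⟨hA'K, hD'K⟩, ⟨hA'v, hD'v⟩, hAD⟩, hmax⟩ :=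
    UpperSemicontinuousOn.exists_isMaxOn hXne hXc
      (((upperSemicontinuous_measure_inter μ hBc).comp continuous_fst).upperSemicontinuousOn X)
  simp only [mem_ofPred_eq] at hA'K hD'K hA'v hD'v hAD
  have hBm : MeasurableSet B := hBc.measurableSet
  have hA'm : MeasurableSet (A' : Set M) := A'.isCompact.measurableSet
  have key : μ (B \ A') = 0 := by
    by_contra hne
    have hfin : μ (A' ∩ B) ≠ ∞ :=
      ((measure_mono inter_subset_right).trans_lt hBc.measure_lt_top).ne
    -- Otherwise `A'` would lie in `B` up to a null set and, having at least the measure of `B`,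
    -- would fill it.
    have hne' : μ (A' \ B) ≠ 0 := by
      intro h0
      have h1 := measure_inter_add_sdiff (μ := μ) (A' : Set M) hBm
      have h2 := measure_inter_add_sdiff (μ := μ) B hA'm
      rw [h0, add_zero] at h1
      rw [inter_comm, h1] at h2
      rw [h1] at hfin
      have h3 : μ A' + μ (B \ A') ≤ μ A' + 0 := by
        rw [h2, add_zero, ← hAB]; exact hA'v
      exact hne (nonpos_iff_eq_zero.1 ((ENNReal.add_le_add_iff_left hfin).1 h3))
    obtain ⟨σ, H, hσ, hσc, hσm, hHc, hoH, hpos⟩ := hrefl (A' \ B) (B \ A') (hA'm.diff hBm)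
      (hBm.diff hA'm) hne' hne (fun u hu w hw => lt_of_le_of_lt hw.1 (not_le.1 hu.2))
    have hmem : ((⟨polarize σ H A', isCompact_polarize hσ.invol hσc hHc A'.isCompact⟩,
        ⟨polarize σ H D', isCompact_polarize hσ.invol hσc hHc D'.isCompact⟩) :
        Compacts M × Compacts M) ∈ X :=
      ⟨⟨hσ.polarize_subset_closedBall hoH hA'K, hσ.polarize_subset_closedBall hoH hD'K⟩,
        ⟨hA'v.trans (measure_le_measure_polarize hσ.invol hσ.mem_or hσm hHc.measurableSet hA'm),
          hD'v.trans (measure_le_measure_polarize hσ.invol hσ.mem_or hσm hHc.measurableSet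
            D'.isCompact.measurableSet)⟩,
        hσ.le_of_polarize hAD⟩
    have h1 := hmax hmem
    -- The ball qualifies as the fixed set because `o ∈ H`: a mirror image in `H` is no farther from
    -- `o`.
    have h2 := measure_inter_add_le_measure_polarize_inter (B := B) hσ.invol hσ.mem_or hσm
      hHc.measurableSet hA'm hBm (fun x hx hxH => by
        have := hσ.le o hoH _ hxH
        rw [hσ.invol] at this
        exact this.trans hx)
    have h3 : μ (A' ∩ B) + μ ((B \ A') ∩ σ ⁻¹' (A' \ B)) ≤ μ (A' ∩ B) + 0 := by
      rw [add_zero]; exact h2.trans h1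
    exact hpos (nonpos_iff_eq_zero.1 ((ENNReal.add_le_add_iff_left hfin).1 h3))
  -- The open ball minus the closed set `A'` is open and null, hence empty; taking closures gives
  -- all of `B`.
  have hsub : B ⊆ A' := by
    refine hball.trans (closure_minimal ?_ A'.isCompact.isClosed)
    have hopen : IsOpen ({y | δ o y < ρ} \ (A' : Set M)) :=
      (isOpen_lt hδo continuous_const).sdiff A'.isCompact.isClosed
    have h0 : μ ({y | δ o y < ρ} \ (A' : Set M)) = 0 :=
      measure_mono_null (sdiff_subset_sdiff_left fun y (hy : δ o y < ρ) => hy.le) key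
    exact sdiff_eq_empty.1 (hopen.measure_eq_zero_iff μ |>.1 h0)
  refine hD'v.trans (measure_mono fun b hb => mem_iInter₂.2 fun x hx => hAD x (hsub hx) b hb)

/-! ### Density points and overlapping images -/

section Density

variable {E : Type*} [NormedAddCommGroup E] [NormedSpace ℝ E] [FiniteDimensional ℝ E]
  [MeasurableSpace E] [BorelSpace E] (μ : Measure E) [μ.IsAddHaarMeasure]

/-- Two sets of positive measure contain points `x` and `y` such that every Lipschitz map which
does not contract volumes too much and takes `x` to `y` makes the sets overlap. -/
theorem exists_forall_measure_image_inter_ne_zero {U W : Set E} (hU : μ U ≠ 0) (hW : μ W ≠ 0)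
    (hWm : MeasurableSet W) : ∃ x ∈ U, ∃ y ∈ W, ∀ (f : E → E) (K c : ℝ), 0 < K → 0 < c →
      (∀ a b, dist (f a) (f b) ≤ K * dist a b) →
      (∀ S, ENNReal.ofReal c * μ S ≤ μ (f '' S)) → f x = y → μ (f '' U ∩ W) ≠ 0 := by
  have hx : ∃ x ∈ U, Tendsto (fun r => μ (U ∩ Metric.closedBall x r) / μ (Metric.closedBall x r))
      (𝓝[>] 0) (𝓝 1) := by
    by_contra! h
    have h1 := Besicovitch.ae_tendsto_measure_inter_div μ U
    have h3 : (μ.restrict U) U = 0 :=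
      measure_mono_null (fun x hx => h x hx) (ae_iff.1 h1)
    exact hU (by rwa [Measure.restrict_apply_self] at h3)
  have hy : ∃ y ∈ W, Tendsto
      (fun r => μ (Wᶜ ∩ Metric.closedBall y r) / μ (Metric.closedBall y r)) (𝓝[>] 0) (𝓝 0) := by
    by_contra! h
    have h1 := Besicovitch.ae_tendsto_measure_inter_div_of_measurableSet μ hWm.compl
    refine hW (measure_mono_null (fun y hy => ?_) (ae_iff.1 h1))
    have := h y hy
    rwa [mem_ofPred_eq, indicator_of_notMem (by simpa using hy)]
  obtain ⟨x, hxU, hx⟩ := hx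
  obtain ⟨y, hyW, hy⟩ := hy
  refine ⟨x, hxU, y, hyW, fun f K c hK hc hf hfμ hxy h0 => ?_⟩
  set n := Module.finrank ℝ E
  have hlim : Tendsto (fun r : ℝ => K * r) (𝓝[>] 0) (𝓝[>] 0) := by
    refine tendsto_nhdsWithin_iff.2 ⟨?_, ?_⟩
    · have : Tendsto (fun r : ℝ => K * r) (𝓝 0) (𝓝 (K * 0)) := tendsto_id.const_mul K
      rw [mul_zero] at this
      exact this.mono_left nhdsWithin_le_nhds
    · filter_upwards [self_mem_nhdsWithin] with r hr using mul_pos hK hr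
  -- If the overlap is null, `f` sends `U` near `x` almost entirely into `Wᶜ` near `y`. In the limit
  -- the density `1` of `U` and the density `0` of `Wᶜ` force `c ≤ 0`.
  have hle : ∀ᶠ r in 𝓝[>] (0 : ℝ),
      ENNReal.ofReal c * (μ (U ∩ Metric.closedBall x r) / μ (Metric.closedBall x r)) ≤
      ENNReal.ofReal (K ^ n) *
        (μ (Wᶜ ∩ Metric.closedBall y (K * r)) / μ (Metric.closedBall y (K * r))) := by
    filter_upwards [self_mem_nhdsWithin] with r hr
    have hr : 0 < r := hr
    have h1 : ENNReal.ofReal c * μ (U ∩ Metric.closedBall x r) ≤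
        μ (Wᶜ ∩ Metric.closedBall y (K * r)) := by
      refine (hfμ _).trans ?_
      rw [← measure_sdiff_null h0]
      refine measure_mono ?_
      rintro _ ⟨⟨z, ⟨hzU, hz⟩, rfl⟩, hz'⟩
      refine ⟨fun h => hz' ⟨mem_image_of_mem _ hzU, h⟩, ?_⟩
      rw [Metric.mem_closedBall, ← hxy]
      exact (hf _ _).trans (by gcongr; exact hz)
    have h2 : μ (Metric.closedBall y (K * r)) =
        ENNReal.ofReal (K ^ n) * μ (Metric.closedBall x r) := by
      rw [Measure.addHaar_closedBall' μ y (by positivity), Measure.addHaar_closedBall' μ x hr.le,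
        mul_pow, ENNReal.ofReal_mul (by positivity), mul_assoc]
    have h3 : ENNReal.ofReal (K ^ n) ≠ 0 := (ENNReal.ofReal_pos.2 (by positivity)).ne'
    rw [h2, ← mul_div_assoc, ← mul_div_assoc, ENNReal.mul_div_mul_left _ _ h3 ENNReal.ofReal_ne_top]
    gcongr
  have h := le_of_tendsto_of_tendsto
    (ENNReal.Tendsto.const_mul hx (Or.inl one_ne_zero))
    (ENNReal.Tendsto.const_mul (hy.comp hlim) (Or.inr ENNReal.ofReal_ne_top)) hle
  rw [mul_one, mul_zero, nonpos_iff_eq_zero, ENNReal.ofReal_eq_zero] at h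
  exact absurd hc (not_lt.2 h)

end Density

/-! ### Transfer between a hypersurface and its cones -/

section Cone

theorem image_smul_image {E : Type*} [AddCommGroup E] [Module ℝ E] {p : E → Prop}
    {σ : Subtype p → Subtype p} {L : E →ₗ[ℝ] E} (hL : ∀ x : Subtype p, L x = σ x)
    (S : Set (Subtype p)) (I : Set ℝ) :
    L '' (I • ((Subtype.val : Subtype p → E) '' S)) = I • (Subtype.val '' (σ '' S)) := by
  ext z
  constructor
  · rintro ⟨_, ⟨t, ht, _, ⟨x, hx, rfl⟩, rfl⟩, rfl⟩
    exact ⟨t, ht, _, ⟨_, ⟨x, hx, rfl⟩, rfl⟩, by simp [hL]⟩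
  · rintro ⟨t, ht, _, ⟨_, ⟨x, hx, rfl⟩, rfl⟩, rfl⟩
    exact ⟨_, ⟨t, ht, _, ⟨x, hx, rfl⟩, rfl⟩, by simp [hL]⟩

variable {E : Type*} [NormedAddCommGroup E] [NormedSpace ℝ E] [FiniteDimensional ℝ E]
  [MeasurableSpace E] [BorelSpace E] {μ : Measure E} [μ.IsAddHaarMeasure]
  {p : E → Prop}

/-- Each ray meets the hypersurface at most once, so scaling is injective on `(0, 1) × S`, and
injective continuous images of Borel sets are Borel. -/
theorem measurableSet_smul_image (hp : MeasurableSet {x | p x})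
    (hinj : ∀ (x y : Subtype p) (t : ℝ), 0 < t → t • (x : E) = y → t = 1)
    {S : Set (Subtype p)} (hS : MeasurableSet S) :
    MeasurableSet (Ioo (0 : ℝ) 1 • ((Subtype.val : Subtype p → E) '' S)) := by
  rw [← image_smul_prod]
  refine (measurableSet_Ioo.prod (hp.subtype_image hS)).image_of_continuousOn_injOn
    (by fun_prop) ?_
  rintro ⟨s, _⟩ ⟨⟨hs, -⟩, x, -, rfl⟩ ⟨t, _⟩ ⟨⟨ht, -⟩, y, -, rfl⟩ h
  dsimp only at h hs ht
  have hst : (t⁻¹ * s) • (x : E) = y := by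
    rw [mul_smul, h, smul_smul, inv_mul_cancel₀ ht.ne', one_smul]
  have h1 := hinj x y _ (by positivity) hst
  rw [h1, one_smul] at hst
  have : s = t := by field_simp at h1; exact h1
  rw [this, hst]

variable {ν : Measure (Subtype p)} {m : ℝ≥0∞} {σ : Subtype p → Subtype p} {L : E →ₗ[ℝ] E}

theorem measurePreserving_of_linear
    (hν : ∀ S, MeasurableSet S → ν S = m * μ (Ioo (0 : ℝ) 1 • (Subtype.val '' S)))
    (hL : ∀ x : Subtype p, L x = σ x) (hdet : |LinearMap.det L| = 1)
    (hσ : Function.Involutive σ) (hσm : Measurable σ) : MeasurePreserving σ ν ν := by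
  refine ⟨hσm, Measure.ext fun S hS => ?_⟩
  rw [Measure.map_apply hσm hS, hν _ (hσm hS), hν S hS,
    ← image_eq_preimage_of_inverse hσ.leftInverse hσ.rightInverse, ← image_smul_image hL,
    Measure.addHaar_image_linearMap, hdet, ENNReal.ofReal_one, one_mul]

theorem exists_forall_measure_inter_preimage_ne_zero (hp : MeasurableSet {x | p x})
    (hinj : ∀ (x y : Subtype p) (t : ℝ), 0 < t → t • (x : E) = y → t = 1)
    (hν : ∀ S, MeasurableSet S → ν S = m * μ (Ioo (0 : ℝ) 1 • (Subtype.val '' S)))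
    (hm : m ≠ 0) {U W : Set (Subtype p)} (hU : MeasurableSet U) (hW : MeasurableSet W)
    (hU0 : ν U ≠ 0) (hW0 : ν W ≠ 0) : ∃ x ∈ U, ∃ y ∈ W,
      ∀ (σ : Subtype p → Subtype p) (L : E →ₗ[ℝ] E), (∀ x : Subtype p, L x = σ x) →
        LinearMap.det L ≠ 0 → Function.Involutive σ → Measurable σ → σ x = y →
        ν (W ∩ σ ⁻¹' U) ≠ 0 := by
  rw [hν U hU] at hU0
  rw [hν W hW] at hW0
  obtain ⟨_, ⟨s, hs, _, ⟨x, hx, rfl⟩, rfl⟩, _, ⟨t, ht, _, ⟨y, hy, rfl⟩, rfl⟩, h⟩ :=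
    exists_forall_measure_image_inter_ne_zero μ (right_ne_zero_of_mul hU0)
      (right_ne_zero_of_mul hW0) (measurableSet_smul_image hp hinj hW)
  refine ⟨x, hx, y, hy, fun σ L hL hdet hσ hσm hxy => ?_⟩
  rw [hν _ (hW.inter (hσm hU))]
  refine mul_ne_zero hm ?_
  have hst : 0 < t / s := div_pos ht.1 hs.1
  -- The density points are `s • x` and `t • y` in the cones; the factor `t / s` makes the linear
  -- map match them.
  set f : E →ₗ[ℝ] E := (t / s) • L with hf
  have hfdet : LinearMap.det f ≠ 0 := by
    rw [hf, LinearMap.det_smul]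
    exact mul_ne_zero (pow_ne_zero _ hst.ne') hdet
  -- Adding `1` to the operator norm makes the Lipschitz constant visibly positive.
  refine fun h0 => h f (‖LinearMap.toContinuousLinearMap f‖ + 1) |LinearMap.det f|
    (by positivity) (abs_pos.2 hfdet) ?_ ?_ ?_ (measure_mono_null ?_ h0)
  · intro a b
    rw [dist_eq_norm, dist_eq_norm, ← map_sub]
    refine ((LinearMap.toContinuousLinearMap f).le_opNorm (a - b)).trans ?_
    gcongr
    exact (le_add_iff_nonneg_right _).2 zero_le_one
  · intro S
    rw [Measure.addHaar_image_linearMap]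
  · simp only [hf, LinearMap.smul_apply, map_smul, hL, hxy, smul_smul]
    rw [mul_div_cancel₀ _ hs.1.ne']
  · rintro _ ⟨⟨_, ⟨a, ha, _, ⟨u, hu, rfl⟩, rfl⟩, rfl⟩, ⟨b, hb, _, ⟨w, hw, rfl⟩, hbw⟩⟩
    simp only [hf, LinearMap.smul_apply, map_smul, hL, smul_smul] at hbw ⊢
    have hc : 0 < b⁻¹ * (a * (t / s)) := mul_pos (inv_pos.2 hb.1) (mul_pos ha.1 hst)
    have h1 : (b⁻¹ * (a * (t / s))) • (σ u : E) = w := by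
      rw [mul_smul, ← hbw, smul_smul, inv_mul_cancel₀ hb.1.ne', one_smul]
    have h2 := hinj _ _ _ hc h1
    rw [h2, one_smul] at h1
    have h3 : σ u = w := Subtype.ext h1
    rw [← hbw]
    exact smul_mem_smul hb ⟨w, ⟨hw, by rw [mem_preimage, ← h3, hσ]; exact hu⟩, rfl⟩

end Cone

/-! ### Reflections with respect to a bilinear form -/

section Form

variable {E : Type*} [AddCommGroup E] [Module ℝ E] (β : E →ₗ[ℝ] E →ₗ[ℝ] ℝ)

/-- The reflection `z ↦ z - 2 β(n, z) / β(n, n) n` with respect to a bilinear form `β`. -/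
noncomputable def formReflection (n : E) : E →ₗ[ℝ] E :=
  LinearMap.id - (2 / β n n) • (β n).smulRight n

theorem formReflection_apply (n z : E) :
    formReflection β n z = z - (2 / β n n * β n z) • n := by
  simp [formReflection, mul_smul]

variable {β}

theorem form_formReflection_left (n a b : E) :
    β (formReflection β n a) b = β a b - 2 / β n n * β n a * β n b := by
  simp [formReflection_apply]

theorem form_formReflection_right (hβ : ∀ a b, β a b = β b a) (n a b : E) :
    β a (formReflection β n b) = β a b - 2 / β n n * β n a * β n b := by
  rw [hβ, form_formReflection_left, hβ b a]
  ring

theorem formReflection_formReflection {n : E} (hn : β n n ≠ 0) (z : E) :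
    formReflection β n (formReflection β n z) = z := by
  rw [formReflection_apply, formReflection_apply, map_sub, map_smul, smul_eq_mul, sub_sub,
    ← add_smul]
  have : 2 / β n n * β n z + 2 / β n n * (β n z - 2 / β n n * β n z * β n n) = 0 := by
    field_simp
    ring
  rw [this, zero_smul, sub_zero]

theorem abs_det_formReflection {n : E} (hn : β n n ≠ 0) :
    |LinearMap.det (formReflection β n)| = 1 := by
  have h : formReflection β n ∘ₗ formReflection β n = LinearMap.id :=
    LinearMap.ext (formReflection_formReflection hn)
  have h1 := congrArg LinearMap.det h
  rw [LinearMap.det_comp, LinearMap.det_id] at h1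
  rcases mul_self_eq_one_iff.1 h1 with h2 | h2 <;> simp [h2]

theorem form_formReflection_formReflection (hβ : ∀ a b, β a b = β b a) {n : E} (hn : β n n ≠ 0)
    (a b : E) : β (formReflection β n a) (formReflection β n b) = β a b := by
  rw [form_formReflection_right hβ, form_formReflection_left, hβ n (formReflection β n a),
    form_formReflection_left, hβ a n]
  field_simp
  ring

/-- Equal squares give `β (x - y) (x - y) = 2 * β (x - y) x`, so exactly `x - y` is subtracted from
`x`. -/
theorem formReflection_sub_apply (hβ : ∀ a b, β a b = β b a) {x y : E} (hxy : β x x = β y y)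
    (hn : β (x - y) (x - y) ≠ 0) : formReflection β (x - y) x = y := by
  have h : β (x - y) (x - y) = 2 * β (x - y) x := by
    simp only [map_sub, LinearMap.sub_apply]
    rw [hβ x y, ← hxy]
    ring
  rw [formReflection_apply]
  have h1 : 2 / β (x - y) (x - y) * β (x - y) x = 1 := by
    rw [div_mul_eq_mul_div, ← h, div_self hn]
  rw [h1, one_smul, sub_sub_cancel]

end Form

/-- The volume inequality for dual sets in a hypersurface of a vector space which has the
measure of the cones over its subsets, and where the distance is a decreasing function of a
bilinear form. -/
theorem measure_rDual_le_of_form {E : Type*} [NormedAddCommGroup E] [NormedSpace ℝ E]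
    [FiniteDimensional ℝ E] [MeasurableSpace E] [BorelSpace E] {μ : Measure E}
    [μ.IsAddHaarMeasure] {p : E → Prop} (ν : Measure (Subtype p)) [IsFiniteMeasureOnCompacts ν]
    [ν.OuterRegular] [ν.IsOpenPosMeasure] {m : ℝ≥0∞} (hm : m ≠ 0) (hp : MeasurableSet {x | p x})
    (hinj : ∀ (x y : Subtype p) (t : ℝ), 0 < t → t • (x : E) = y → t = 1)
    (hν : ∀ S, MeasurableSet S → ν S = m * μ (Ioo (0 : ℝ) 1 • (Subtype.val '' S)))
    (β : E →ₗ[ℝ] E →ₗ[ℝ] ℝ) (hβ : ∀ a b, β a b = β b a) {κ : ℝ}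
    (hself : ∀ x : Subtype p, β x x = κ)
    (hpos : ∀ x y : Subtype p, x ≠ y → 0 < β ((x : E) - y) ((x : E) - y))
    (hrefl : ∀ x y z : Subtype p, x ≠ y → p (formReflection β ((x : E) - y) z))
    {δ : Subtype p → Subtype p → ℝ} (hδ : Continuous (Function.uncurry δ))
    (hδβ : ∀ a b c e, δ a b ≤ δ c e ↔ β (c : E) e ≤ β (a : E) b)
    (hcpt : ∀ x R, IsCompact (closedBall δ x R))
    {o : Subtype p} {ρ : ℝ} (hball : closedBall δ o ρ ⊆ closure {y | δ o y < ρ})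
    {r : ℝ} {A : Set (Subtype p)} (hA : IsCompact A) (hA0 : A.Nonempty)
    (hAB : ν A = ν (closedBall δ o ρ)) :
    ν (rDual δ A r) ≤ ν (rDual δ (closedBall δ o ρ) r) := by
  refine measure_rDual_le_of_reflections ν hδ hcpt hball ?_ hA hA0 hAB
  intro U W hU hW hU0 hW0 hUW
  obtain ⟨x, hx, y, hy, h⟩ :=
    exists_forall_measure_inter_preimage_ne_zero hp hinj hν hm hU hW hU0 hW0
  have hxy : x ≠ y := fun e => (hUW x hx y hy).ne (by rw [e])
  have hn := hpos x y hxy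
  set n : E := x - y with hndef
  set σ : Subtype p → Subtype p := fun z => ⟨formReflection β n z, hrefl x y z hxy⟩ with hσdef
  have hσ : Function.Involutive σ := fun z =>
    Subtype.ext (formReflection_formReflection hn.ne' _)
  have hσc : Continuous σ :=
    ((formReflection β n).continuous_of_finiteDimensional.comp continuous_subtype_val).subtype_mk _
  have hβc : Continuous fun z : Subtype p => β n z :=
    (β n).continuous_of_finiteDimensional.comp continuous_subtype_val
  have hdet := abs_det_formReflection hn.ne'
  have hβσ : ∀ z, β n (formReflection β n z) = - β n z := fun z => by
    rw [form_formReflection_right hβ]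
    field_simp
    ring
  have heq : ∀ a b c e : Subtype p, β (a : E) b = β (c : E) e → δ a b = δ c e := fun a b c e he =>
    le_antisymm ((hδβ _ _ _ _).2 he.ge) ((hδβ _ _ _ _).2 he.le)
  -- With `n = x - y`, this is the side of the mirror containing `y`, and also `o`, since `y` is
  -- nearer to `o` than `x`.
  refine ⟨σ, {z | β n z ≤ 0}, ⟨hσ, fun a b => ?_, fun a => ?_, fun a ha b hb => ?_⟩, hσc,
    measurePreserving_of_linear hν (fun _ => rfl) hdet hσ hσc.measurable,
    isClosed_le hβc continuous_const, ?_,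
    h σ (formReflection β n) (fun _ => rfl) (fun h0 => by simp [h0] at hdet) hσ hσc.measurable
      (Subtype.ext (formReflection_sub_apply hβ ((hself x).trans (hself y).symm) hn.ne'))⟩
  · exact heq _ _ _ _ (form_formReflection_formReflection hβ hn.ne' _ _)
  · rcases le_total (β n a) 0 with h0 | h0
    · exact Or.inl h0
    · refine Or.inr ?_
      change β n (formReflection β n a) ≤ 0
      rw [hβσ]
      linarith
  · rw [hδβ]
    change β a (formReflection β n b) ≤ β a b
    rw [form_formReflection_right hβ]
    have : 0 ≤ 2 / β n n * (β n a * β n b) :=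
      mul_nonneg (by positivity) (mul_nonneg_of_nonpos_of_nonpos ha hb)
    linarith
  · have h1 := (hδβ _ _ _ _).1 (hUW x hx y hy).le
    change β n o ≤ 0
    rw [hndef, map_sub, LinearMap.sub_apply, hβ x o, hβ y o]
    linarith

/-! ### Euclidean space -/

section Euclidean

variable {E : Type*} [NormedAddCommGroup E] [InnerProductSpace ℝ E] [FiniteDimensional ℝ E]
  [MeasurableSpace E] [BorelSpace E]

theorem closedBall_dist {X : Type*} [PseudoMetricSpace X] (x : X) (R : ℝ) :
    closedBall dist x R = Metric.closedBall x R := by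
  ext y
  rw [Metric.mem_closedBall, dist_comm]
  rfl

theorem measurePreserving_of_abs_det_eq_one {L : E →ₗ[ℝ] E} (h : |LinearMap.det L| = 1) :
    MeasurePreserving L (volume : Measure E) volume := by
  refine ⟨L.continuous_of_finiteDimensional.measurable, ?_⟩
  rw [Measure.map_linearMap_addHaar_eq_smul_addHaar _ (fun h0 => by simp [h0] at h), abs_inv, h]
  simp

theorem volume_rDual_le_of_dist {r : ℝ} {A : Set E} (hA : IsCompact A) (hA0 : A.Nonempty)
    {c : E} {ρ : ℝ} (hρ : 0 < ρ) (hAB : volume A = volume (closedBall dist c ρ)) :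
    volume (rDual dist A r) ≤ volume (rDual dist (closedBall dist c ρ) r) := by
  refine measure_rDual_le_of_reflections volume (by fun_prop)
    (fun x R => by rw [closedBall_dist]; exact isCompact_closedBall x R) ?_ ?_ hA hA0 hAB
  · have : {y | dist c y < ρ} = Metric.ball c ρ := by
      ext y
      rw [Metric.mem_ball, dist_comm]
      rfl
    rw [this, closure_ball _ hρ.ne', closedBall_dist]
  · intro U W hU hW hU0 hW0 hUW
    obtain ⟨x, hx, y, hy, h⟩ := exists_forall_measure_image_inter_ne_zero volume hU0 hW0 hW
    set β : E →ₗ[ℝ] E →ₗ[ℝ] ℝ := innerₗ E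
    have hβ : ∀ a b, β a b = β b a := fun a b => by
      simp only [β, innerₗ_apply_apply, real_inner_comm]
    have hβd : ∀ a b, dist a b = √(β (a - b) (a - b)) := fun a b => by
      rw [innerₗ_apply_apply, dist_eq_norm, norm_eq_sqrt_real_inner]
    set n := x - y with hndef
    set m := (2⁻¹ : ℝ) • (x + y) with hmdef
    have hxy : x ≠ y := fun e => (hUW x hx y hy).ne (by rw [e])
    have hn : 0 < β n n := by
      rw [innerₗ_apply_apply]
      exact real_inner_self_pos.2 (sub_ne_zero.2 hxy)
    set R := formReflection β n with hR
    have hRR := formReflection_formReflection hn.ne'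
    -- Reflection in the perpendicular bisector of `x` and `y`, which passes through the midpoint
    -- `m`.
    set σ : E → E := fun z => R (z - m) + m with hσdef
    have hσ : Function.Involutive σ := fun z => by simp [hσdef, hR, hRR]
    have hβR : ∀ z, β n (R z) = - β n z := fun z => by
      rw [hR, form_formReflection_right hβ]
      field_simp
      ring
    have hiso : ∀ a b, dist (σ a) (σ b) = dist a b := fun a b => by
      rw [hβd, hβd, add_sub_add_right_eq_sub, ← map_sub,
        form_formReflection_formReflection hβ hn.ne', sub_sub_sub_cancel_right]
    have hσc : Continuous σ :=
      (R.continuous_of_finiteDimensional.comp (by fun_prop)).add continuous_const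
    have hdet : |LinearMap.det R| = 1 := abs_det_formReflection hn.ne'
    have hσm : MeasurePreserving σ volume volume :=
      (measurePreserving_add_right volume m).comp
        ((measurePreserving_of_abs_det_eq_one hdet).comp (measurePreserving_sub_right volume m))
    have hxm : x - m = (2⁻¹ : ℝ) • n := by rw [hndef, hmdef]; module
    have hσx : σ x = y := by
      have h1 : R n = -n := by
        rw [hR, formReflection_apply, div_mul_cancel₀ _ hn.ne', two_smul]
        abel
      simp only [hσdef]
      rw [hxm, map_smul, h1, hndef, hmdef]
      module
    have hβc : Continuous fun z => β n (z - m) :=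
      (β n).continuous_of_finiteDimensional.comp (by fun_prop)
    refine ⟨σ, {z | β n (z - m) ≤ 0}, ⟨hσ, hiso, fun a => ?_, fun a ha b hb => ?_⟩, hσc, hσm,
      isClosed_le hβc continuous_const, ?_, ?_⟩
    · rcases le_total (β n (a - m)) 0 with h0 | h0
      · exact Or.inl h0
      · refine Or.inr ?_
        simp only [mem_ofPred_eq, hσdef, add_sub_cancel_right, hβR]
        linarith
    · rw [hβd, hβd]
      refine Real.sqrt_le_sqrt ?_
      have h1 : a - b = (a - m) - (b - m) := by abel
      have h2 : a - σ b = (a - m) - R (b - m) := by simp only [hσdef]; abel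
      have h3 : β (R (b - m)) (R (b - m)) = β (b - m) (b - m) :=
        form_formReflection_formReflection hβ hn.ne' _ _
      have h4 : ∀ u v, β (u - v) (u - v) = β u u - 2 * β u v + β v v := fun u v => by
        simp only [map_sub, LinearMap.sub_apply]
        rw [hβ v u]
        ring
      rw [h1, h2, h4 (a - m) (b - m), h4 (a - m) (R (b - m)), h3, form_formReflection_right hβ]
      have : 0 ≤ 2 / β n n * (β n (a - m) * β n (b - m)) :=
        mul_nonneg (by positivity) (mul_nonneg_of_nonpos_of_nonpos ha hb)
      linarith
    · have h1 := (hUW x hx y hy).le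
      rw [hβd, hβd, Real.sqrt_le_sqrt_iff (by rw [innerₗ_apply_apply]; exact real_inner_self_nonneg)]
        at h1
      have h2 : c - y = (c - m) + (2⁻¹ : ℝ) • n := by rw [hndef, hmdef]; module
      have h3 : c - x = (c - m) - (2⁻¹ : ℝ) • n := by rw [hndef, hmdef]; module
      rw [h2, h3] at h1
      simp only [map_sub, map_add, map_smul, LinearMap.sub_apply, LinearMap.add_apply,
        LinearMap.smul_apply, smul_eq_mul] at h1
      have h4 := hβ n c
      have h5 := hβ n m
      change β n (c - m) ≤ 0
      rw [map_sub]
      linarith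
    · have h1 := h σ 1 1 one_pos one_pos (fun a b => by rw [hiso, one_mul]) (fun S => ?_) hσx
      · rwa [inter_comm, image_eq_preimage_of_inverse hσ.leftInverse hσ.rightInverse] at h1
      · rw [ENNReal.ofReal_one, one_mul]
        let e : E ≃ᵐ E := ⟨hσ.toPerm, hσm.measurable, hσm.measurable⟩
        have he : MeasurePreserving e volume volume := hσm
        rw [image_eq_preimage_of_inverse hσ.leftInverse hσ.rightInverse]
        exact (he.measure_preimage_equiv S).ge

end Euclidean

/-! ### Spherical space -/

section Spherical

variable {d : ℕ}

theorem sphDist_eq_arccos (x y : Sph d) :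
    sphDist x y = Real.arccos ⟪(x : EuclideanSpace ℝ (Fin (d + 1))), y⟫ := by
  rw [sphDist, InnerProductGeometry.angle, norm_eq_of_mem_sphere, norm_eq_of_mem_sphere]
  simp

theorem inner_mem_Icc (x y : Sph d) :
    ⟪(x : EuclideanSpace ℝ (Fin (d + 1))), y⟫ ∈ Icc (-1 : ℝ) 1 := by
  have := abs_real_inner_le_norm (x : EuclideanSpace ℝ (Fin (d + 1))) y
  rw [norm_eq_of_mem_sphere, norm_eq_of_mem_sphere, one_mul] at this
  exact abs_le.1 this

theorem sph_inner_self (x : Sph d) : ⟪(x : EuclideanSpace ℝ (Fin (d + 1))), x⟫ = 1 := by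
  rw [real_inner_self_eq_norm_sq, norm_eq_of_mem_sphere, one_pow]

theorem continuous_sphDist : Continuous (Function.uncurry (sphDist (d := d))) := by
  have : Function.uncurry (sphDist (d := d)) = fun q : Sph d × Sph d =>
      Real.arccos ⟪(q.1 : EuclideanSpace ℝ (Fin (d + 1))), q.2⟫ :=
    funext fun q => sphDist_eq_arccos q.1 q.2
  rw [this]
  exact Real.continuous_arccos.comp (by fun_prop)

theorem exists_unit_inner_eq_zero (hd : 0 < d) (x : Sph d) :
    ∃ u : EuclideanSpace ℝ (Fin (d + 1)), ‖u‖ = 1 ∧ ⟪(x : EuclideanSpace ℝ (Fin (d + 1))), u⟫ = 0 := by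
  have hx : (x : EuclideanSpace ℝ (Fin (d + 1))) ≠ 0 := fun h => by
    simpa [h] using norm_eq_of_mem_sphere x
  have : Fact (Module.finrank ℝ (EuclideanSpace ℝ (Fin (d + 1))) = d + 1) := ⟨by simp⟩
  have h1 := Submodule.finrank_orthogonal_span_singleton (𝕜 := ℝ) (n := d) hx
  have : Nontrivial (ℝ ∙ (x : EuclideanSpace ℝ (Fin (d + 1))))ᗮ :=
    Module.nontrivial_of_finrank_pos (R := ℝ) (by rw [h1]; exact hd)
  obtain ⟨u, hu⟩ := exists_norm_eq (ℝ ∙ (x : EuclideanSpace ℝ (Fin (d + 1))))ᗮ zero_le_one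
  exact ⟨u, hu, Submodule.mem_orthogonal_singleton_iff_inner_right.1 u.2⟩

/-- The point `o` lies on a unit speed geodesic starting at `x`. -/
theorem exists_sph_decomposition (hd : 0 < d) (o x : Sph d) :
    ∃ u : EuclideanSpace ℝ (Fin (d + 1)), ‖u‖ = 1 ∧
      ⟪(x : EuclideanSpace ℝ (Fin (d + 1))), u⟫ = 0 ∧
      (o : EuclideanSpace ℝ (Fin (d + 1))) =
        Real.cos (sphDist o x) • (x : EuclideanSpace ℝ (Fin (d + 1))) + Real.sin (sphDist o x) • u := by
  have hc := inner_mem_Icc o x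
  have hcos : Real.cos (sphDist o x) = ⟪(o : EuclideanSpace ℝ (Fin (d + 1))), x⟫ := by
    rw [sphDist_eq_arccos, Real.cos_arccos hc.1 hc.2]
  set θ := sphDist o x
  set v := (o : EuclideanSpace ℝ (Fin (d + 1))) - Real.cos θ • (x : EuclideanSpace ℝ (Fin (d + 1)))
    with hv
  have hxv : ⟪(x : EuclideanSpace ℝ (Fin (d + 1))), v⟫ = 0 := by
    rw [hv, inner_sub_right, inner_smul_right, sph_inner_self, real_inner_comm, hcos]
    ring
  have hvv : ‖v‖ ^ 2 = Real.sin θ ^ 2 := by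
    rw [hv, ← real_inner_self_eq_norm_sq, inner_sub_sub_self]
    simp only [inner_smul_right, inner_smul_left, sph_inner_self, hcos,
      real_inner_comm (o : EuclideanSpace ℝ (Fin (d + 1))), conj_trivial, Real.sin_sq]
    ring
  have hs : 0 ≤ Real.sin θ :=
    Real.sin_nonneg_of_nonneg_of_le_pi (InnerProductGeometry.angle_nonneg _ _)
      (InnerProductGeometry.angle_le_pi _ _)
  have hvn : ‖v‖ = Real.sin θ := (sq_eq_sq₀ (norm_nonneg _) hs).1 hvv
  rcases hs.eq_or_lt with h0 | h0
  -- Here `o = ± x`, so the direction is not determined and any unit tangent vector at `x` serves.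
  · obtain ⟨u, hu, hxu⟩ := exists_unit_inner_eq_zero hd x
    refine ⟨u, hu, hxu, ?_⟩
    rw [← h0, norm_eq_zero] at hvn
    rw [← h0, zero_smul, add_zero]
    exact sub_eq_zero.1 hvn
  · refine ⟨(Real.sin θ)⁻¹ • v, ?_, ?_, ?_⟩
    · rw [norm_smul, hvn, norm_inv, Real.norm_of_nonneg hs, inv_mul_cancel₀ h0.ne']
    · rw [inner_smul_right, hxv, mul_zero]
    · rw [smul_smul, mul_inv_cancel₀ h0.ne', one_smul, hv]
      abel

/-- A boundary point `x` is approached along the geodesic towards `o`: after time `t` the distance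
to `o` is `ρ - t`. -/
theorem sph_closedBall_subset_closure (hd : 0 < d) (o : Sph d) {ρ : ℝ} (hρ : 0 < ρ) :
    closedBall sphDist o ρ ⊆ closure {y | sphDist o y < ρ} := by
  intro x hx
  obtain ⟨u, hu, hxu, ho⟩ := exists_sph_decomposition hd o x
  have hx : sphDist o x ≤ ρ := hx
  have hπ : sphDist o x ≤ Real.pi := InnerProductGeometry.angle_le_pi _ _
  rcases hx.lt_or_eq with h | h
  · exact subset_closure h
  set θ := sphDist o x
  rw [closure_subtype]
  have hlim : Tendsto (fun t : ℝ => Real.cos t • (x : EuclideanSpace ℝ (Fin (d + 1))) +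
      Real.sin t • u) (𝓝[>] 0) (𝓝 (x : EuclideanSpace ℝ (Fin (d + 1)))) := by
    have : Continuous (fun t : ℝ => Real.cos t • (x : EuclideanSpace ℝ (Fin (d + 1))) +
      Real.sin t • u) := by fun_prop
    have h1 := this.tendsto 0
    simp only [Real.cos_zero, Real.sin_zero, one_smul, zero_smul, add_zero] at h1
    exact h1.mono_left nhdsWithin_le_nhds
  refine mem_closure_of_tendsto hlim ?_
  have hθ : 0 < θ := hρ.trans_eq h.symm
  filter_upwards [Ioo_mem_nhdsGT hθ] with t ht
  have huu : ⟪u, u⟫ = 1 := by rw [real_inner_self_eq_norm_sq, hu, one_pow]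
  have hux : ⟪u, (x : EuclideanSpace ℝ (Fin (d + 1)))⟫ = 0 := by rw [real_inner_comm, hxu]
  have hy : Real.cos t • (x : EuclideanSpace ℝ (Fin (d + 1))) + Real.sin t • u ∈
      Metric.sphere (0 : EuclideanSpace ℝ (Fin (d + 1))) 1 := by
    rw [mem_sphere_zero_iff_norm, ← sq_eq_sq₀ (norm_nonneg _) zero_le_one,
      ← real_inner_self_eq_norm_sq]
    simp only [inner_add_left, inner_add_right, inner_smul_left, inner_smul_right, huu, hux, hxu,
      sph_inner_self, conj_trivial]
    nlinarith [Real.sin_sq_add_cos_sq t]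
  refine ⟨⟨_, hy⟩, ?_, rfl⟩
  rw [mem_ofPred_eq, sphDist_eq_arccos]
  have : ⟪(o : EuclideanSpace ℝ (Fin (d + 1))),
      Real.cos t • (x : EuclideanSpace ℝ (Fin (d + 1))) + Real.sin t • u⟫ = Real.cos (θ - t) := by
    rw [ho]
    simp only [inner_add_left, inner_add_right, inner_smul_left, inner_smul_right, huu, hux, hxu,
      sph_inner_self, conj_trivial, Real.cos_sub]
    ring
  rw [this, Real.arccos_cos (by linarith [ht.2]) (by linarith [ht.1])]
  linarith [ht.1]

theorem sphVol_rDual_le (hd : 0 < d) {r : ℝ} {A : Set (Sph d)} (hA : IsCompact A)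
    (hA0 : A.Nonempty) {c : Sph d} {ρ : ℝ} (hρ : 0 < ρ)
    (hAB : sphVol d A = sphVol d (closedBall sphDist c ρ)) :
    sphVol d (rDual sphDist A r) ≤ sphVol d (rDual sphDist (closedBall sphDist c ρ) r) := by
  have : IsFiniteMeasure (sphVol d) := by unfold sphVol; infer_instance
  have : (sphVol d).IsOpenPosMeasure := by unfold sphVol; infer_instance
  have hβ : ∀ a b : EuclideanSpace ℝ (Fin (d + 1)),
      innerₗ (EuclideanSpace ℝ (Fin (d + 1))) a b = innerₗ (EuclideanSpace ℝ (Fin (d + 1))) b a :=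
    fun a b => by simp only [innerₗ_apply_apply, real_inner_comm]
  have hpos : ∀ x y : Sph d, x ≠ y → 0 < innerₗ (EuclideanSpace ℝ (Fin (d + 1)))
      ((x : EuclideanSpace ℝ (Fin (d + 1))) - y) ((x : EuclideanSpace ℝ (Fin (d + 1))) - y) :=
    fun x y hxy => by
      rw [innerₗ_apply_apply]
      exact real_inner_self_pos.2 (sub_ne_zero.2 fun h => hxy (Subtype.ext h))
  refine measure_rDual_le_of_form (p := fun x => x ∈ Metric.sphere _ _) (μ := volume)
    (m := (Module.finrank ℝ (EuclideanSpace ℝ (Fin (d + 1))) : ℝ≥0∞)) (sphVol d)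
    (by simp) Metric.isClosed_sphere.measurableSet ?_
    (fun S hS => Measure.toSphere_apply' _ hS) (innerₗ _) hβ (κ := 1) sph_inner_self hpos ?_
    continuous_sphDist ?_ ?_ (sph_closedBall_subset_closure hd c hρ) hA hA0 hAB
  · intro x y t ht h
    have h1 := congrArg norm h
    rwa [norm_smul, norm_eq_of_mem_sphere, norm_eq_of_mem_sphere, mul_one,
      Real.norm_of_nonneg ht.le] at h1
  · intro x y z hxy
    rw [mem_sphere_zero_iff_norm, ← sq_eq_sq₀ (norm_nonneg _) zero_le_one,
      ← real_inner_self_eq_norm_sq, ← innerₗ_apply_apply,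
      form_formReflection_formReflection hβ (hpos x y hxy).ne', innerₗ_apply_apply,
      sph_inner_self, one_pow]
  · intro a b a' b'
    rw [sphDist_eq_arccos, sphDist_eq_arccos]
    exact Real.strictAntiOn_arccos.le_iff_ge (inner_mem_Icc a b) (inner_mem_Icc a' b')
  · intro x R
    exact (isClosed_le (continuous_sphDist.comp (by fun_prop : Continuous fun y : Sph d => (x, y)))
      continuous_const).isCompact

end Spherical

/-! ### Hyperbolic space -/

section Hyperbolic

variable {d : ℕ}

/-- The Lorentz form as a bilinear map. -/
noncomputable def lorentzForm (d : ℕ) :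
    EuclideanSpace ℝ (Fin (d + 1)) →ₗ[ℝ] EuclideanSpace ℝ (Fin (d + 1)) →ₗ[ℝ] ℝ :=
  LinearMap.mk₂ ℝ lorentz
    (fun x y z => by
      simp only [lorentz, PiLp.add_apply, add_mul, Finset.sum_add_distrib]; ring)
    (fun c x y => by
      simp only [lorentz, PiLp.smul_apply, smul_eq_mul, mul_assoc, Finset.mul_sum, mul_sub])
    (fun x y z => by
      simp only [lorentz, PiLp.add_apply, mul_add, Finset.sum_add_distrib]; ring)
    (fun c x y => by
      simp only [lorentz, PiLp.smul_apply, smul_eq_mul, mul_left_comm _ c, Finset.mul_sum, mul_sub])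

theorem lorentzForm_apply (x y : EuclideanSpace ℝ (Fin (d + 1))) :
    lorentzForm d x y = lorentz x y := rfl

theorem lorentz_comm (x y : EuclideanSpace ℝ (Fin (d + 1))) : lorentz x y = lorentz y x := by
  simp only [lorentz, mul_comm]

/-- The reverse Cauchy–Schwarz inequality on the hyperboloid, squared. -/
theorem sq_lorentz_add_le {x y : EuclideanSpace ℝ (Fin (d + 1))} (hx : lorentz x x = -1)
    (hy : lorentz y y = -1) :
    (lorentz x y + x 0 * y 0) ^ 2 ≤ (x 0 ^ 2 - 1) * (y 0 ^ 2 - 1) := by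
  have h := Finset.sum_mul_sq_le_sq_mul_sq Finset.univ (fun i : Fin d => x i.succ)
    (fun i : Fin d => y i.succ)
  simp only [lorentz, ← sq] at hx hy
  rw [lorentz, sub_add_cancel]
  rwa [show ∑ i : Fin d, x i.succ ^ 2 = x 0 ^ 2 - 1 by linarith,
    show ∑ i : Fin d, y i.succ ^ 2 = y 0 ^ 2 - 1 by linarith] at h

theorem one_le_apply_zero (x : Hyp d) : 1 ≤ x.1 0 := by
  have h := x.2.1
  have h1 : 0 ≤ ∑ i : Fin d, x.1 i.succ * x.1 i.succ :=
    Finset.sum_nonneg fun i _ => mul_self_nonneg _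
  rw [lorentz] at h
  nlinarith [x.2.2]

/-- The equality case of reverse Cauchy–Schwarz: first the heights `x 0`, `y 0` agree, then the
squared spatial distance is at most `0`. -/
theorem eq_of_neg_one_le_lorentz {x y : Hyp d} (h : -1 ≤ lorentz x.1 y.1) : x = y := by
  have h1 := sq_lorentz_add_le x.2.1 y.2.1
  have hx := one_le_apply_zero x
  have hy := one_le_apply_zero y
  have hxy : 1 ≤ x.1 0 * y.1 0 := one_le_mul_of_one_le_of_one_le hx hy
  have h0 : x.1 0 = y.1 0 := by
    have : (x.1 0 - y.1 0) ^ 2 ≤ 0 := by nlinarith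
    nlinarith [pow_eq_zero_iff (two_ne_zero) |>.1 (le_antisymm this (sq_nonneg _))]
  have h2 : ∑ i : Fin d, (x.1 i.succ - y.1 i.succ) ^ 2 ≤ 0 := by
    have h3 : ∑ i : Fin d, (x.1 i.succ - y.1 i.succ) ^ 2 =
        lorentz x.1 x.1 - 2 * lorentz x.1 y.1 + lorentz y.1 y.1 + (x.1 0 - y.1 0) ^ 2 := by
      simp only [lorentz, sub_sq, Finset.sum_add_distrib, Finset.sum_sub_distrib, Finset.mul_sum,
        mul_assoc, ← sq, mul_sub]
      ring
    rw [h3, x.2.1, y.2.1, h0]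
    nlinarith
  have h3 := (Finset.sum_eq_zero_iff_of_nonneg fun i _ => sq_nonneg _).1
    (le_antisymm h2 (Finset.sum_nonneg fun i _ => sq_nonneg _))
  apply Subtype.ext
  ext i
  refine Fin.cases h0 (fun j => ?_) i
  have := h3 j (Finset.mem_univ j)
  exact sub_eq_zero.1 (pow_eq_zero_iff two_ne_zero |>.1 this)

theorem lorentz_le_neg_one (x y : Hyp d) : lorentz x.1 y.1 ≤ -1 := by
  by_contra h
  have := eq_of_neg_one_le_lorentz (not_le.1 h).le
  rw [this, y.2.1] at h
  exact h le_rfl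

theorem lorentz_sub_sub_pos {x y : Hyp d} (h : x ≠ y) :
    0 < lorentzForm d (x.1 - y.1) (x.1 - y.1) := by
  have h1 : lorentz x.1 y.1 < -1 := not_le.1 fun h' => h (eq_of_neg_one_le_lorentz h')
  simp only [map_sub, LinearMap.sub_apply, lorentzForm_apply, x.2.1, y.2.1, lorentz_comm y.1 x.1]
  linarith

/-- On the lower sheet `-w` would be a point of `Hyp d`, making `lorentz w y` at least `1`. This is
how reflected and interpolated points are seen to be on the upper sheet. -/
theorem apply_zero_pos_of_lorentz_neg {w : EuclideanSpace ℝ (Fin (d + 1))} (hw : lorentz w w = -1)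
    {y : Hyp d} (h : lorentz w y.1 < 0) : 0 < w 0 := by
  by_contra h0
  have hw0 : w 0 ≠ 0 := fun h1 => by
    have h2 : 0 ≤ ∑ i : Fin d, w i.succ * w i.succ :=
      Finset.sum_nonneg fun i _ => mul_self_nonneg _
    rw [lorentz, h1] at hw
    linarith
  have hneg : lorentz ((-1 : ℝ) • w) ((-1 : ℝ) • w) = -1 := by
    rw [lorentz_smul_smul, hw]; norm_num
  have h1 := lorentz_le_neg_one ⟨(-1 : ℝ) • w, hneg, by
    have : w 0 < 0 := lt_of_le_of_ne (not_lt.1 h0) hw0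
    simpa using this⟩ y
  have h2 := lorentz_smul_smul (-1) 1 w y.1
  rw [one_smul] at h2
  dsimp only at h1
  linarith

/-- Bounded distance from `x` thus bounds the height, and with `norm_le_two_mul` the norm; this
gives compactness of balls. -/
theorem apply_zero_le (x y : Hyp d) : y.1 0 ≤ 2 * x.1 0 * -lorentz x.1 y.1 := by
  have h1 := sq_lorentz_add_le x.2.1 y.2.1
  have hx := one_le_apply_zero x
  have hy := one_le_apply_zero y
  have h2 : y.1 0 * y.1 0 ≤ y.1 0 * (2 * x.1 0 * -lorentz x.1 y.1) := by
    nlinarith [sq_nonneg (lorentz x.1 y.1)]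
  exact le_of_mul_le_mul_left h2 (by linarith)

theorem norm_le_two_mul (y : Hyp d) : ‖y.1‖ ≤ 2 * y.1 0 := by
  have hy := one_le_apply_zero y
  have h := y.2.1
  simp only [lorentz, ← sq] at h
  rw [EuclideanSpace.norm_eq, Real.sqrt_le_left (by linarith), Fin.sum_univ_succ]
  simp only [Real.norm_eq_abs, sq_abs]
  nlinarith

theorem continuous_lorentz :
    Continuous fun q : EuclideanSpace ℝ (Fin (d + 1)) × EuclideanSpace ℝ (Fin (d + 1)) =>
      lorentz q.1 q.2 := by
  unfold lorentz
  fun_prop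

theorem isClosed_hyp : IsClosed {x : EuclideanSpace ℝ (Fin (d + 1)) | lorentz x x = -1 ∧ 0 < x 0} := by
  have : {x : EuclideanSpace ℝ (Fin (d + 1)) | lorentz x x = -1 ∧ 0 < x 0} =
      {x | lorentz x x = -1} ∩ {x | 1 ≤ x 0} := by
    ext x
    exact ⟨fun h => ⟨h.1, one_le_apply_zero ⟨x, h⟩⟩,
      fun h => ⟨h.1, zero_lt_one.trans_le (show (1 : ℝ) ≤ x 0 from h.2)⟩⟩
  rw [this]
  exact (isClosed_eq continuous_lorentz_self continuous_const).inter
    (isClosed_le continuous_const (by fun_prop))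

theorem continuous_hypDist : Continuous (Function.uncurry (hypDist (d := d))) := by
  refine Real.continuousOn_arcosh.comp_continuous
    (f := fun q : Hyp d × Hyp d => -lorentz q.1.1 q.2.1) ?_ fun q => ?_
  · exact (continuous_lorentz.comp (by fun_prop :
      Continuous fun q : Hyp d × Hyp d => (q.1.1, q.2.1))).neg
  · have := lorentz_le_neg_one q.1 q.2
    rw [mem_Ici]
    linarith

theorem cosh_hypDist (x y : Hyp d) : Real.cosh (hypDist x y) = -lorentz x.1 y.1 :=
  Real.cosh_arcosh (by linarith [lorentz_le_neg_one x y])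

theorem hypDist_nonneg (x y : Hyp d) : 0 ≤ hypDist x y :=
  Real.arcosh_nonneg (by linarith [lorentz_le_neg_one x y])

theorem isCompact_hyp_closedBall (x : Hyp d) (R : ℝ) : IsCompact (closedBall hypDist x R) := by
  have h1 : IsCompact ((Subtype.val : Hyp d → EuclideanSpace ℝ (Fin (d + 1))) ⁻¹'
      Metric.closedBall 0 (2 * (2 * x.1 0 * Real.cosh R))) :=
    isClosed_hyp.isClosedEmbedding_subtypeVal.isCompact_preimage (isCompact_closedBall _ _)
  refine h1.of_isClosed_subset (isClosed_le (continuous_hypDist.comp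
    (by fun_prop : Continuous fun y : Hyp d => (x, y))) continuous_const) fun y hy => ?_
  have hy : hypDist x y ≤ R := hy
  rw [mem_preimage, mem_closedBall_zero_iff]
  have h2 : -lorentz x.1 y.1 ≤ Real.cosh R := by
    rw [← cosh_hypDist, Real.cosh_le_cosh, abs_of_nonneg (hypDist_nonneg x y)]
    exact hy.trans (le_abs_self R)
  have hx := x.2.2
  calc ‖y.1‖ ≤ 2 * y.1 0 := norm_le_two_mul y
    _ ≤ 2 * (2 * x.1 0 * -lorentz x.1 y.1) := by gcongr; exact apply_zero_le x y
    _ ≤ _ := by gcongr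

theorem hyp_closedBall_subset_closure (o : Hyp d) {ρ : ℝ} (hρ : 0 < ρ) :
    closedBall hypDist o ρ ⊆ closure {y | hypDist o y < ρ} := by
  intro x hx
  rcases (show hypDist o x ≤ ρ from hx).lt_or_eq with h | h
  · exact subset_closure h
  have hcosh := cosh_hypDist o x
  rw [h] at hcosh
  have hs : 0 < Real.sinh ρ := Real.sinh_pos_iff.2 hρ
  -- The unit speed geodesic from `x` to `o`, written by hyperbolic interpolation; `f t` has
  -- distance `ρ - t` from `o`.
  set f : ℝ → EuclideanSpace ℝ (Fin (d + 1)) := fun t =>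
    (Real.sinh ρ)⁻¹ • (Real.sinh (ρ - t) • x.1 + Real.sinh t • o.1) with hf
  rw [closure_subtype]
  have hlim : Tendsto f (𝓝[>] 0) (𝓝 x.1) := by
    have h0 : Continuous f := by fun_prop
    have h1 := h0.tendsto 0
    simp only [hf, sub_zero, Real.sinh_zero, zero_smul, add_zero, smul_smul,
      inv_mul_cancel₀ hs.ne', one_smul] at h1
    exact h1.mono_left nhdsWithin_le_nhds
  refine mem_closure_of_tendsto hlim ?_
  filter_upwards [Ioo_mem_nhdsGT hρ] with t ht
  have hox : lorentz o.1 x.1 = -Real.cosh ρ := by linarith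
  have hadd := Real.cosh_sq ρ
  have hadd' := Real.cosh_sq t
  have hself : lorentz (f t) (f t) = -1 := by
    rw [← lorentzForm_apply]
    simp only [hf, map_add, map_smul, LinearMap.add_apply, LinearMap.smul_apply, smul_eq_mul,
      lorentzForm_apply, o.2.1, x.2.1, lorentz_comm x.1 o.1, hox, Real.sinh_sub]
    field_simp
    ring_nf
    rw [show Real.cosh ρ ^ 2 = Real.sinh ρ ^ 2 + 1 from hadd,
      show Real.cosh t ^ 2 = Real.sinh t ^ 2 + 1 from hadd']
    ring
  have ho : lorentz o.1 (f t) = -Real.cosh (ρ - t) := by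
    rw [← lorentzForm_apply]
    simp only [hf, map_add, map_smul, smul_eq_mul, lorentzForm_apply, o.2.1, hox, Real.sinh_sub,
      Real.cosh_sub]
    field_simp
    ring_nf
    rw [show Real.cosh ρ ^ 2 = Real.sinh ρ ^ 2 + 1 from hadd]
    ring
  refine ⟨⟨f t, hself, apply_zero_pos_of_lorentz_neg (y := o) hself ?_⟩, ?_, rfl⟩
  · rw [lorentz_comm, ho]
    linarith [Real.cosh_pos (ρ - t)]
  · change Real.arcosh (-lorentz o.1 (f t)) < ρ
    rw [ho, neg_neg, Real.arcosh_cosh (by linarith [ht.2])]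
    linarith [ht.1]

theorem continuous_radialProj : Continuous (radialProj (d := d)) := by
  have h1 : Continuous fun v : FutureCone d => √(-lorentz v.1 v.1) :=
    (continuous_lorentz_self.comp continuous_subtype_val).neg.sqrt
  exact ((h1.inv₀ fun v => (Real.sqrt_pos.2 (neg_pos.2 v.2.1)).ne').smul
    continuous_subtype_val).subtype_mk _

theorem isOpen_futureCone :
    IsOpen {v : EuclideanSpace ℝ (Fin (d + 1)) | lorentz v v < 0 ∧ 0 < v 0} := by
  have h : Continuous fun v : EuclideanSpace ℝ (Fin (d + 1)) => v 0 := by fun_prop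
  exact (isOpen_lt continuous_lorentz_self continuous_const).inter
    (isOpen_lt continuous_const h)

instance isOpenPosMeasure_hypVol : (hypVol d).IsOpenPosMeasure := by
  refine ⟨fun S hS hne h0 => ?_⟩
  obtain ⟨x, hx⟩ := hne
  rw [hypVol, Measure.smul_apply, Measure.map_apply measurable_radialProj hS.measurableSet,
    Measure.restrict_apply (measurable_radialProj hS.measurableSet),
    nsmul_eq_mul, mul_eq_zero] at h0
  have h0 := h0.resolve_left (by simp)
  erw [(MeasurableEmbedding.subtype_coe (measurableSet_futureCone d)).comap_apply] at h0
  have hopen : IsOpen ((Subtype.val : FutureCone d → EuclideanSpace ℝ (Fin (d + 1))) ''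
      (radialProj ⁻¹' S ∩ {v | -1 < lorentz v.1 v.1})) :=
    isOpen_futureCone.isOpenEmbedding_subtypeVal.isOpenMap _
      ((hS.preimage continuous_radialProj).inter
        (isOpen_lt continuous_const (continuous_lorentz_self.comp continuous_subtype_val)))
  -- The point `x / 2` witnesses that the open truncated cone over `S` is nonempty.
  have hl : lorentz ((2⁻¹ : ℝ) • x.1) ((2⁻¹ : ℝ) • x.1) = -4⁻¹ := by
    rw [lorentz_smul_smul, x.2.1]; norm_num
  have hmem : lorentz ((2⁻¹ : ℝ) • x.1) ((2⁻¹ : ℝ) • x.1) < 0 ∧ 0 < ((2⁻¹ : ℝ) • x.1) 0 :=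
    ⟨by rw [hl]; norm_num, mul_pos (by norm_num) x.2.2⟩
  have hproj : radialProj ⟨(2⁻¹ : ℝ) • x.1, hmem⟩ = x := by
    apply Subtype.ext
    simp only [radialProj]
    rw [hl, neg_neg, show (4⁻¹ : ℝ) = 2⁻¹ * 2⁻¹ by norm_num, Real.sqrt_mul_self (by norm_num),
      inv_inv, smul_smul]
    norm_num
  refine (hopen.measure_pos volume ⟨_, ⟨_, hmem⟩, ⟨?_, ?_⟩, rfl⟩).ne' h0
  · rw [mem_preimage, hproj]; exact hx
  · rw [mem_ofPred_eq, hl]; norm_num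

instance isFiniteMeasureOnCompacts_hypVol : IsFiniteMeasureOnCompacts (hypVol d) := by
  refine ⟨fun K hK => ?_⟩
  rw [hypVol_apply hK.measurableSet]
  refine ENNReal.mul_lt_top (by finiteness) ?_
  obtain ⟨R, hR⟩ := (hK.image continuous_subtype_val).isBounded.exists_norm_le
  refine (measure_mono ?_).trans_lt (isCompact_closedBall
    (0 : EuclideanSpace ℝ (Fin (d + 1))) R).measure_lt_top
  rintro _ ⟨t, ht, x, hx, rfl⟩
  rw [mem_closedBall_zero_iff]
  refine (norm_smul_le _ _).trans ?_
  rw [Real.norm_of_nonneg ht.1.le]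
  exact (mul_le_of_le_one_left (norm_nonneg _) ht.2.le).trans (hR x hx)

theorem hypVol_rDual_le {r : ℝ} {A : Set (Hyp d)} (hA : IsCompact A)
    (hA0 : A.Nonempty) {c : Hyp d} {ρ : ℝ} (hρ : 0 < ρ)
    (hAB : hypVol d A = hypVol d (closedBall hypDist c ρ)) :
    hypVol d (rDual hypDist A r) ≤ hypVol d (rDual hypDist (closedBall hypDist c ρ) r) := by
  have : LocallyCompactSpace (Hyp d) := isClosed_hyp.isClosedEmbedding_subtypeVal.locallyCompactSpace
  have hβ : ∀ a b, lorentzForm d a b = lorentzForm d b a := lorentz_comm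
  refine measure_rDual_le_of_form (p := fun x => lorentz x x = -1 ∧ 0 < x 0) (μ := volume)
    (m := (d + 1 : ℝ≥0∞)) (hypVol d) (by simp) isClosed_hyp.measurableSet ?_
    (fun S hS => hypVol_apply hS) (lorentzForm d) hβ (κ := -1) (fun x => x.2.1)
    (fun x y => lorentz_sub_sub_pos) ?_ continuous_hypDist ?_ isCompact_hyp_closedBall
    (hyp_closedBall_subset_closure c hρ) hA hA0 hAB
  · intro x y t ht h
    have h1 := lorentz_smul_smul t t x.1 x.1
    rw [h, y.2.1, x.2.1] at h1
    nlinarith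
  · intro x y z hxy
    have hn := (lorentz_sub_sub_pos hxy).ne'
    have hself : lorentz (formReflection (lorentzForm d) (x.1 - y.1) z.1)
        (formReflection (lorentzForm d) (x.1 - y.1) z.1) = -1 :=
      (form_formReflection_formReflection hβ hn z.1 z.1).trans z.2.1
    -- The reflection takes `x` to `y`, so the image of `z` pairs with `y` as `z` does with `x`,
    -- which is negative.
    refine ⟨hself, apply_zero_pos_of_lorentz_neg (y := y) hself ?_⟩
    have h1 := form_formReflection_formReflection hβ hn z.1 x.1
    rw [formReflection_sub_apply hβ (x.2.1.trans y.2.1.symm) hn, lorentzForm_apply,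
      lorentzForm_apply] at h1
    rw [h1]
    linarith [lorentz_le_neg_one z x]
  · intro a b a' b'
    have h1 := lorentz_le_neg_one a b
    have h2 := lorentz_le_neg_one a' b'
    rw [hypDist, hypDist, Real.arcosh_le_arcosh (by linarith) (by linarith), neg_le_neg_iff]
    rfl

end Hyperbolic

end SpaceForm

theorem theorem1 (d : ℕ) (hd : 1 < d) :
    -- Euclidean space
    (∀ (r : ℝ), 0 < r →
      ∀ A : Set (EuclideanSpace ℝ (Fin d)), IsCompact A → 0 < volume A →
      ∀ (c : EuclideanSpace ℝ (Fin d)) (ρ : ℝ), 0 < ρ →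
        volume A = volume (SpaceForm.closedBall dist c ρ) →
        volume (SpaceForm.rDual dist A r) ≤
          volume (SpaceForm.rDual dist (SpaceForm.closedBall dist c ρ) r)) ∧
    -- hyperbolic space
    (∀ (r : ℝ), 0 < r →
      ∀ A : Set (SpaceForm.Hyp d), IsCompact A → 0 < SpaceForm.hypVol d A →
      ∀ (c : SpaceForm.Hyp d) (ρ : ℝ), 0 < ρ →
        SpaceForm.hypVol d A =
          SpaceForm.hypVol d (SpaceForm.closedBall SpaceForm.hypDist c ρ) →
        SpaceForm.hypVol d (SpaceForm.rDual SpaceForm.hypDist A r) ≤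
          SpaceForm.hypVol d (SpaceForm.rDual SpaceForm.hypDist
            (SpaceForm.closedBall SpaceForm.hypDist c ρ) r)) ∧
    -- spherical space
    (∀ (r : ℝ), 0 < r → r ≤ Real.pi / 2 →
      ∀ A : Set (SpaceForm.Sph d), IsCompact A → 0 < SpaceForm.sphVol d A →
      ∀ (c : SpaceForm.Sph d) (ρ : ℝ), 0 < ρ →
        SpaceForm.sphVol d A =
          SpaceForm.sphVol d (SpaceForm.closedBall SpaceForm.sphDist c ρ) →
        SpaceForm.sphVol d (SpaceForm.rDual SpaceForm.sphDist A r) ≤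
          SpaceForm.sphVol d (SpaceForm.rDual SpaceForm.sphDist
            (SpaceForm.closedBall SpaceForm.sphDist c ρ) r)) := by
  have hne : ∀ {M : Type} [MeasurableSpace M] {μ : Measure M} {A : Set M}, 0 < μ A → A.Nonempty :=
    fun h => nonempty_of_measure_ne_zero h.ne'
  exact ⟨fun r _ A hA hA0 c ρ hρ hAB => SpaceForm.volume_rDual_le_of_dist hA (hne hA0) hρ hAB,
    fun r _ A hA hA0 c ρ hρ hAB => SpaceForm.hypVol_rDual_le hA (hne hA0) hρ hAB,
    fun r _ _ A hA hA0 c ρ hρ hAB =>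
      SpaceForm.sphVol_rDual_le (zero_lt_one.trans hd) hA (hne hA0) hρ hAB⟩
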